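/- Let $n\ge 1$, $\alpha\in\mathbb R$, and let $V\in L^\infty_{loc}(\mathbb R^n\setminus\{0\})$ be real-valued, positive on $\mathbb R^n\setminus\{0\}$ and homogeneous of order $\alpha$, that is, $V(tx)=t^\alpha V(x)$ for all $t>0$ and $x\neq 0$. Assume that $\alpha>-2$ if $n\le 2$, and that $\alpha\ge n-4$ if $n\ge 3$. Let $u\in L^\infty(\mathbb R^n)$ be a real-valued bounded weak solution to $-\Delta u=Vu$ on $\mathbb R^n$, that is, $Vu\in L^1_{loc}(\mathbb R^n)$ and $$-\int_{\mathbb R^n}u\,\Delta\varphi\,dx=\int_{\mathbb R^n}Vu\,\varphi\,dx\qquad\text{for all }\varphi\in C_c^\infty(\mathbb R^n).$$ If $u$ is not almost everywhere zero on $\mathbb R^n$, then $u$ changes sign near $\infty$: for every $R$, the sets $\{|x|>R,\ u(x)>0\}$ and $\{|x|>R,\ u(x)<0\}$ both have positive Lebesgue measure. (Equivalently, if for some $R$ one has $u\ge 0$ a.e. on $\{|x|>R\}$, or $u\le 0$ a.e. on $\{|x|>R\}$, then $u=0$ a.e. on $\mathbb R^n$.) -/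

import Mathlib

open MeasureTheory Laplacian
open scoped ContDiff ENNReal

/-- The function `f` belongs to `L^∞_loc(U)`: it is (a.e. strongly) measurable and essentially
bounded on every compact subset of `U`. -/
def MemLinftyLoc {n : ℕ} (f : EuclideanSpace ℝ (Fin n) → ℝ)
    (U : Set (EuclideanSpace ℝ (Fin n))) : Prop :=
  ∀ K : Set (EuclideanSpace ℝ (Fin n)), IsCompact K → K ⊆ U → MemLp f ∞ (volume.restrict K)

/-- The function `f` is homogeneous of order `α` on `ℝⁿ ∖ {0}`. -/
def IsHomogeneousOfOrder {n : ℕ} (α : ℝ) (f : EuclideanSpace ℝ (Fin n) → ℝ) : Prop :=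
  ∀ t : ℝ, 0 < t → ∀ x : EuclideanSpace ℝ (Fin n), x ≠ 0 → f (t • x) = t ^ α * f x

/-- The function `u` is a weak (distributional) solution of `-Δ u = V u` on `ℝⁿ`: both `u` and
`V u` are locally integrable on `ℝⁿ` (so that both sides are distributions), and the equation
holds when tested against every smooth compactly supported function. -/
structure IsWeakSolution {n : ℕ} (V u : EuclideanSpace ℝ (Fin n) → ℝ) : Prop where
  locallyIntegrable : LocallyIntegrable u volume
  locallyIntegrable_mul : LocallyIntegrable (fun x => V x * u x) volume
  integral_eq : ∀ φ : EuclideanSpace ℝ (Fin n) → ℝ, ContDiff ℝ ∞ φ → HasCompactSupport φ →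
    -∫ x, u x * (Δ φ) x = ∫ x, V x * u x * φ x

/-- The function `u`, considered up to null sets, changes sign near infinity: outside every ball
around the origin it is positive on a set of positive measure and negative on a set of positive
measure. In other words, `u` is neither a.e. nonnegative nor a.e. nonpositive outside any ball. -/
def ChangesSignNearInfinity {n : ℕ} (u : EuclideanSpace ℝ (Fin n) → ℝ) : Prop :=
  ∀ R : ℝ, (∃ᵐ x ∂(volume : Measure (EuclideanSpace ℝ (Fin n))), R < ‖x‖ ∧ 0 < u x) ∧
    (∃ᵐ x ∂(volume : Measure (EuclideanSpace ℝ (Fin n))), R < ‖x‖ ∧ u x < 0)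

/-!
If `u` does not change sign near infinity, we may assume `u ≥ 0` outside a ball.

Every half-space `Ω` avoiding that ball is stable under the dilations `x ↦ t x` with `t ≥ 1`. By the
minimum principle `u` either vanishes or is positive on `Ω`. In the second case, Picone's
inequality gives `∫ V φ² ≤ ∫ |∇φ|²` for all test functions `φ` in `Ω`. Replacing `φ` by `φ(x / t)`
multiplies the left-hand side by `t ^ (n + α)` and the right-hand side by `t ^ (n - 2)`, which is
absurd as `t → ∞` because `α > -2`. Hence `u` vanishes on all these half-spaces, that is, outside
the ball.

For compactly supported `u` the function `v(x) = u(t x)` solves `-Δ v = t² V(t x) v` with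
`V(t x) = t ^ α V(x)`, so that the symmetry of the Laplacian gives
`(t ^ (α + 2) - 1) ∫ V(x) u(t x) u(x) dx = 0`. Dividing by the factor and letting `t → 1` leads
to `∫ V u² = 0`.
-/

open Filter Topology Metric Set Module
open scoped Convolution RealInnerProductSpace

section LaplacianCalculus

variable {E F ι : Type*} [NormedAddCommGroup E] [InnerProductSpace ℝ E] [FiniteDimensional ℝ E]
  [NormedAddCommGroup F] [NormedSpace ℝ F] [Fintype ι] {f : E → F}

lemma laplacian_eq_sum_fderiv_fderiv (hf : ContDiff ℝ 2 f) (b : OrthonormalBasis ι ℝ E) (x : E) :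
    (Δ f) x = ∑ i, fderiv ℝ (fun y => fderiv ℝ f y (b i)) x (b i) := by
  have hf' : DifferentiableAt ℝ (fderiv ℝ f) x :=
    (hf.fderiv_right (m := 1) (by norm_num)).differentiable (by simp) x
  rw [InnerProductSpace.laplacian_eq_iteratedFDeriv_orthonormalBasis f b]
  refine Finset.sum_congr rfl fun i _ => ?_
  rw [iteratedFDeriv_two_apply, fderiv_clm_apply hf' (differentiableAt_const _)]
  simp

lemma laplacian_comp_add_smul (hf : ContDiff ℝ 2 f) (a : E) (c : ℝ) (x : E) :
    (Δ fun y => f (a + c • y)) x = c ^ 2 • (Δ f) (a + c • x) := by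
  have hchain {g : E → F} (y v : E) :
      fderiv ℝ (fun y => g (a + c • y)) y v = c • fderiv ℝ g (a + c • y) v := by
    rw [fderiv_comp_smul (f := fun z => g (a + z)) c, fderiv_comp_add_left]
    rfl
  have _hf' : Differentiable ℝ (fderiv ℝ f) :=
    (hf.fderiv_right (m := 1) (by norm_num)).differentiable (by simp)
  have hcomp (v : E) : DifferentiableAt ℝ (fun y => fderiv ℝ f (a + c • y) v) x := by fun_prop
  rw [laplacian_eq_sum_fderiv_fderiv (by fun_prop) (stdOrthonormalBasis ℝ E),
    laplacian_eq_sum_fderiv_fderiv hf (stdOrthonormalBasis ℝ E), Finset.smul_sum]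
  refine Finset.sum_congr rfl fun i _ => ?_
  simp only [hchain]
  rw [fderiv_fun_const_smul (hcomp _), smul_apply,
    hchain (g := fun y => fderiv ℝ f y _), smul_smul, sq]

lemma sum_sq_apply_orthonormalBasis (L : E →L[ℝ] ℝ) (b : OrthonormalBasis ι ℝ E) :
    ∑ i, L (b i) ^ 2 = ‖L‖ ^ 2 := by
  obtain ⟨a, rfl⟩ := (InnerProductSpace.toDual ℝ E).surjective L
  simp [InnerProductSpace.toDual_apply_apply, b.sum_sq_inner_left]

end LaplacianCalculus

section Picone

variable {E : Type*} [NormedAddCommGroup E] {φ w : E → ℝ}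

section NormedSpace

variable [NormedSpace ℝ E]

lemma contDiff_sq_div (hφ : ContDiff ℝ 1 φ) (hw : ContDiff ℝ 1 w)
    (hpos : ∀ x ∈ tsupport φ, 0 < w x) : ContDiff ℝ 1 fun x => φ x ^ 2 / w x := by
  refine contDiff_iff_contDiffAt.mpr fun x => ?_
  by_cases hx : x ∈ tsupport φ
  · exact (hφ.contDiffAt.pow 2).div hw.contDiffAt (hpos x hx).ne'
  · refine (contDiffAt_const (c := (0 : ℝ))).congr_of_eventuallyEq ?_
    filter_upwards [notMem_tsupport_iff_eventuallyEq.mp hx] with y hy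
    simp [hy]

-- Expanding, the difference of the two sides is `(∂ᵥφ - φ ∂ᵥw / w)²`.
lemma fderiv_sq_div_mul_fderiv_le (hφ : ContDiff ℝ 1 φ) (hw : ContDiff ℝ 1 w)
    (hpos : ∀ x ∈ tsupport φ, 0 < w x) (x v : E) :
    fderiv ℝ (fun x => φ x ^ 2 / w x) x v * fderiv ℝ w x v ≤ fderiv ℝ φ x v ^ 2 := by
  by_cases hx : x ∈ tsupport φ
  · have hwx := hpos x hx
    have hinv : HasFDerivAt (fun x => (w x)⁻¹) (-(w x ^ 2)⁻¹ • fderiv ℝ w x) x :=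
      (hasDerivAt_inv hwx.ne').comp_hasFDerivAt x (hw.differentiable (by simp) x).hasFDerivAt
    have hq := ((hφ.differentiable (by simp) x).hasFDerivAt.pow 2).fun_mul hinv
    simp only [div_eq_mul_inv]
    rw [hq.fderiv]
    refine sub_nonneg.mp ((sq_nonneg (fderiv ℝ φ x v - φ x * fderiv ℝ w x v / w x)).trans_eq ?_)
    simp only [smul_apply, add_apply, smul_eq_mul]
    field_simp
    ring
  · have hzero : (fun x => φ x ^ 2 / w x) =ᶠ[𝓝 x] fun _ => 0 := by
      filter_upwards [notMem_tsupport_iff_eventuallyEq.mp hx] with y hy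
      simp [hy]
    simp [hzero.fderiv_eq, sq_nonneg]

variable [MeasurableSpace E] [BorelSpace E]

lemma integrable_fderiv_apply_sq {μ : Measure E} [IsFiniteMeasureOnCompacts μ]
    (hφ : ContDiff ℝ 1 φ) (hφc : HasCompactSupport φ) (v : E) :
    Integrable (fun x => fderiv ℝ φ x v ^ 2) μ := by
  have hcont : Continuous fun x => fderiv ℝ φ x v :=
    (hφ.continuous_fderiv (by simp)).clm_apply continuous_const
  simpa only [sq, Pi.mul_def] using
    (hcont.mul hcont).integrable_of_hasCompactSupport (hφc.fderiv_apply ℝ v).mul_right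

lemma integral_sq_div_mul_neg_fderiv_fderiv_le [FiniteDimensional ℝ E]
    {μ : Measure E} [μ.IsAddHaarMeasure]
    (hφ : ContDiff ℝ 1 φ) (hφc : HasCompactSupport φ) (hw : ContDiff ℝ 2 w)
    (hpos : ∀ x ∈ tsupport φ, 0 < w x) (v : E) :
    ∫ x, φ x ^ 2 / w x * -fderiv ℝ (fun y => fderiv ℝ w y v) x v ∂μ ≤
      ∫ x, fderiv ℝ φ x v ^ 2 ∂μ := by
  set q : E → ℝ := fun x => φ x ^ 2 / w x
  have hq : ContDiff ℝ 1 q := contDiff_sq_div hφ (hw.of_le (by norm_num)) hpos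
  have hqc : HasCompactSupport q :=
    hφc.mono' fun x hx => subset_tsupport φ fun h => hx (by simp [q, h])
  have hw' : ContDiff ℝ 1 fun y => fderiv ℝ w y v :=
    (hw.fderiv_right (by norm_num)).clm_apply contDiff_const
  have hq'c : Continuous fun x => fderiv ℝ q x v :=
    (hq.continuous_fderiv (by simp)).clm_apply continuous_const
  have hw''c : Continuous fun x => fderiv ℝ (fun y => fderiv ℝ w y v) x v :=
    (hw'.continuous_fderiv (by simp)).clm_apply continuous_const
  have hint : Integrable (fun x => fderiv ℝ q x v * fderiv ℝ w x v) μ :=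
    (hq'c.mul hw'.continuous).integrable_of_hasCompactSupport (hqc.fderiv_apply ℝ v).mul_right
  have hparts := integral_mul_fderiv_eq_neg_fderiv_mul_of_integrable (v := v) hint
    ((hq.continuous.mul hw''c).integrable_of_hasCompactSupport hqc.mul_right)
    ((hq.continuous.mul hw'.continuous).integrable_of_hasCompactSupport hqc.mul_right)
    (fun x _ => hq.differentiable (by simp) x) (fun x _ => hw'.differentiable (by simp) x)
  calc ∫ x, q x * -fderiv ℝ (fun y => fderiv ℝ w y v) x v ∂μ
      = ∫ x, fderiv ℝ q x v * fderiv ℝ w x v ∂μ := by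
        simp only [mul_neg, integral_neg, hparts, neg_neg]
    _ ≤ ∫ x, fderiv ℝ φ x v ^ 2 ∂μ := by
        exact integral_mono hint (integrable_fderiv_apply_sq hφ hφc v)
          (fderiv_sq_div_mul_fderiv_le hφ (hw.of_le (by norm_num)) hpos · v)

end NormedSpace

variable [InnerProductSpace ℝ E] [FiniteDimensional ℝ E] [MeasurableSpace E] [BorelSpace E]

lemma integral_sq_div_mul_neg_laplacian_le (hφ : ContDiff ℝ 1 φ) (hφc : HasCompactSupport φ)
    (hw : ContDiff ℝ 2 w) (hpos : ∀ x ∈ tsupport φ, 0 < w x) :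
    ∫ x, φ x ^ 2 / w x * -(Δ w) x ≤ ∫ x, ‖fderiv ℝ φ x‖ ^ 2 := by
  set b := stdOrthonormalBasis ℝ E
  have hqc : HasCompactSupport fun x => φ x ^ 2 / w x :=
    hφc.mono' fun x hx => subset_tsupport φ fun h => hx (by simp [h])
  simp only [laplacian_eq_sum_fderiv_fderiv hw b, ← sum_sq_apply_orthonormalBasis _ b,
    ← Finset.sum_neg_distrib, Finset.mul_sum]
  rw [integral_finsetSum, integral_finsetSum]
  · exact Finset.sum_le_sum fun i _ =>
      integral_sq_div_mul_neg_fderiv_fderiv_le hφ hφc hw hpos (b i)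
  · exact fun i _ => integrable_fderiv_apply_sq hφ hφc (b i)
  · intro i _
    have hw' : ContDiff ℝ 1 fun y => fderiv ℝ w y (b i) :=
      (hw.fderiv_right (by norm_num)).clm_apply contDiff_const
    exact ((contDiff_sq_div hφ (hw.of_le (by norm_num)) hpos).continuous.mul
      ((hw'.continuous_fderiv (by simp)).clm_apply
        continuous_const).neg).integrable_of_hasCompactSupport hqc.mul_right

end Picone

section Dilation

variable {E : Type*} [NormedAddCommGroup E] [NormedSpace ℝ E]

/-- The mass-preserving dilation of `g` by the factor `r`: the approximate identity generated by
the kernel `g` is `dilate r g` for `r → 0`. -/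
noncomputable def dilate (r : ℝ) (g : E → ℝ) (x : E) : ℝ :=
  (r ^ finrank ℝ E)⁻¹ * g (r⁻¹ • x)

variable {g u : E → ℝ} {r : ℝ}

lemma contDiff_dilate {n : ℕ∞ω} (hg : ContDiff ℝ n g) (r : ℝ) : ContDiff ℝ n (dilate r g) :=
  contDiff_const.mul (hg.comp (contDiff_const_smul r⁻¹))

lemma contDiffOn_uncurry_dilate {n : ℕ∞ω} (hg : ContDiff ℝ n g) :
    ContDiffOn ℝ n ↿(fun s => dilate s g) (Ioi 0 ×ˢ univ) := by
  have hinv : ContDiffOn ℝ n (fun p : ℝ × E => p.1⁻¹) (Ioi 0 ×ˢ univ) :=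
    contDiff_fst.contDiffOn.inv fun p hp => hp.1.ne'
  have hpow : ContDiffOn ℝ n (fun p : ℝ × E => (p.1 ^ finrank ℝ E)⁻¹) (Ioi 0 ×ˢ univ) := by
    simpa only [inv_pow] using hinv.pow (finrank ℝ E)
  exact hpow.mul (hg.comp_contDiffOn (hinv.smul contDiff_snd.contDiffOn))

lemma dilate_nonneg (hg : ∀ x, 0 ≤ g x) (hr : 0 < r) (x : E) : 0 ≤ dilate r g x :=
  mul_nonneg (by positivity) (hg _)

lemma dilate_eq_zero (hg : ∀ x, 1 ≤ ‖x‖ → g x = 0) (hr : 0 < r) {x : E} (hx : r ≤ ‖x‖) :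
    dilate r g x = 0 := by
  have hx' : 1 ≤ ‖r⁻¹ • x‖ := by
    rw [norm_smul, norm_inv, Real.norm_of_nonneg hr.le, inv_mul_eq_div]
    exact (one_le_div hr).mpr hx
  simp [dilate, hg _ hx']

lemma dilate_pos (hg : ∀ x, ‖x‖ < 1 → 0 < g x) (hr : 0 < r) {x : E} (hx : ‖x‖ < r) :
    0 < dilate r g x := by
  refine mul_pos (by positivity) (hg _ ?_)
  rwa [norm_smul, norm_inv, Real.norm_of_nonneg hr.le, inv_mul_lt_one₀ hr]

lemma tsupport_dilate_subset (hg : ∀ x, 1 ≤ ‖x‖ → g x = 0) (hr : 0 < r) :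
    tsupport (dilate r g) ⊆ closedBall 0 r := by
  refine closure_minimal (fun x hx => ?_) isClosed_closedBall
  rw [mem_closedBall_zero_iff]
  contrapose! hx
  exact Function.notMem_support.mpr (dilate_eq_zero hg hr hx.le)

variable [FiniteDimensional ℝ E]

lemma hasCompactSupport_dilate (hg : ∀ x, 1 ≤ ‖x‖ → g x = 0) (hr : 0 < r) :
    HasCompactSupport (dilate r g) :=
  (isCompact_closedBall 0 r).of_isClosed_subset (isClosed_tsupport _) (tsupport_dilate_subset hg hr)

variable [MeasurableSpace E] [BorelSpace E] {μ : Measure E} [μ.IsAddHaarMeasure]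

lemma integral_dilate (g : E → ℝ) (hr : 0 < r) : ∫ x, dilate r g x ∂μ = ∫ x, g x ∂μ := by
  simp only [dilate]
  rw [integral_const_mul, Measure.integral_comp_inv_smul_of_nonneg μ g hr.le, smul_eq_mul,
    inv_mul_cancel_left₀ (by positivity)]

lemma ae_tendsto_convolution_dilate (hu : LocallyIntegrable u μ) (hg : Continuous g)
    (hg0 : ∀ x, 1 ≤ ‖x‖ → g x = 0) (hg1 : ∫ x, g x ∂μ = 1) :
    ∀ᵐ x ∂μ, Tendsto (fun r => (u ⋆[.lsmul ℝ ℝ, μ] dilate r g) x) (𝓝[>] 0) (𝓝 (u x)) := by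
  have hgc : HasCompactSupport g := .intro (isCompact_closedBall 0 1) fun x hx =>
    hg0 x (not_le.mp (mt mem_closedBall_zero_iff.mpr hx)).le
  obtain ⟨M, hM⟩ := hg.bounded_above_of_compact_support hgc
  filter_upwards [(Besicovitch.vitaliFamily μ).ae_tendsto_average_norm_sub hu] with x hx
  simp only [convolution_def, ContinuousLinearMap.lsmul_apply, smul_eq_mul, mul_comm (u _)]
  refine tendsto_integral_smul_of_tendsto_average_norm_sub (M * μ.real (ball (0 : E) 1))
    (hx.comp (Besicovitch.tendsto_filterAt μ x)) ?_ ?_ ?_ ?_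
  · exact .of_forall fun r => hu.integrableOn_isCompact (isCompact_closedBall _ _)
  · refine tendsto_const_nhds.congr' ?_
    filter_upwards [self_mem_nhdsWithin] with r hr
    rw [integral_sub_left_eq_self (dilate r g) μ x, integral_dilate g hr, hg1]
  · filter_upwards [self_mem_nhdsWithin] with r hr y hy
    have hxy : x - y ∈ closedBall 0 r := tsupport_dilate_subset hg0 hr (subset_tsupport _ hy)
    rwa [mem_closedBall_zero_iff, ← dist_eq_norm, ← mem_closedBall'] at hxy
  · filter_upwards [self_mem_nhdsWithin] with r (hr : 0 < r) y
    have hball : 0 < μ.real (ball (0 : E) 1) :=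
      ENNReal.toReal_pos (measure_ball_pos μ 0 one_pos).ne' measure_ball_lt_top.ne
    rw [Measure.addHaar_real_closedBall _ _ hr.le, mul_div_mul_right _ _ hball.ne', dilate,
      abs_mul, abs_of_pos (by positivity), inv_mul_eq_div]
    gcongr
    exact hM _

end Dilation

section Kernel

variable {E : Type*} [NormedAddCommGroup E]

/-- A smooth radial function supported in the unit ball whose gradient at `x` is the multiple
`-bumpKernel x • x` of the position vector. -/
noncomputable def bumpPotential (x : E) : ℝ := expNegInvGlue (1 - ‖x‖ ^ 2)

/-- The smooth radial kernel, positive exactly on the open unit ball, that relates the gradient of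
`bumpPotential` to the position vector. -/
noncomputable def bumpKernel (x : E) : ℝ :=
  2 * ((1 - ‖x‖ ^ 2)⁻¹ ^ 2 * expNegInvGlue (1 - ‖x‖ ^ 2))

lemma bumpPotential_nonneg (x : E) : 0 ≤ bumpPotential x := expNegInvGlue.nonneg _

lemma bumpPotential_eq_zero {x : E} (hx : 1 ≤ ‖x‖) : bumpPotential x = 0 :=
  expNegInvGlue.zero_of_nonpos (by nlinarith)

lemma bumpKernel_eq_zero {x : E} (hx : 1 ≤ ‖x‖) : bumpKernel x = 0 := by
  rw [bumpKernel, expNegInvGlue.zero_of_nonpos (by nlinarith), mul_zero, mul_zero]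

lemma bumpKernel_pos {x : E} (hx : ‖x‖ < 1) : 0 < bumpKernel x := by
  have h : 0 < 1 - ‖x‖ ^ 2 := by nlinarith [norm_nonneg x]
  have := expNegInvGlue.pos_of_pos h
  unfold bumpKernel
  positivity

lemma bumpKernel_nonneg (x : E) : 0 ≤ bumpKernel x :=
  (lt_or_ge ‖x‖ 1).elim (fun h => (bumpKernel_pos h).le) fun h => (bumpKernel_eq_zero h).ge

variable [InnerProductSpace ℝ E]

lemma contDiff_bumpPotential : ContDiff ℝ ∞ (bumpPotential : E → ℝ) :=
  expNegInvGlue.contDiff.comp (contDiff_const.sub (contDiff_norm_sq ℝ))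

lemma contDiff_bumpKernel : ContDiff ℝ ∞ (bumpKernel : E → ℝ) := by
  have h := expNegInvGlue.contDiff_polynomial_eval_inv_mul (n := ⊤) (Polynomial.X ^ 2)
  simp only [Polynomial.eval_pow, Polynomial.eval_X] at h
  exact contDiff_const.mul (h.comp (contDiff_const.sub (contDiff_norm_sq ℝ)))

lemma hasDerivAt_expNegInvGlue (t : ℝ) :
    HasDerivAt expNegInvGlue (t⁻¹ ^ 2 * expNegInvGlue t) t := by
  simpa using expNegInvGlue.hasDerivAt_polynomial_eval_inv_mul 1 t

lemma fderiv_bumpPotential (x v : E) :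
    fderiv ℝ bumpPotential x v = -(bumpKernel x * ⟪x, v⟫) := by
  have h := (hasDerivAt_expNegInvGlue (1 - ‖x‖ ^ 2)).comp_hasFDerivAt x
    ((hasStrictFDerivAt_norm_sq x).hasFDerivAt.const_sub 1)
  rw [show bumpPotential = expNegInvGlue ∘ fun x : E => 1 - ‖x‖ ^ 2 from rfl, h.fderiv]
  simp only [inv_pow, smul_neg, neg_apply, smul_apply, coe_innerSL_apply, nsmul_eq_mul,
    Nat.cast_ofNat, smul_eq_mul, bumpKernel, neg_inj]
  ring

variable [FiniteDimensional ℝ E]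

lemma laplacian_bumpPotential (x : E) :
    (Δ (bumpPotential : E → ℝ)) x = -(finrank ℝ E * bumpKernel x + fderiv ℝ bumpKernel x x) := by
  set b := stdOrthonormalBasis ℝ E
  have hΨ : ContDiff ℝ 2 (bumpPotential : E → ℝ) := contDiff_infty.mp contDiff_bumpPotential 2
  have hK : DifferentiableAt ℝ (bumpKernel : E → ℝ) x :=
    contDiff_bumpKernel.differentiable (by simp) x
  have hpartial (v : E) : fderiv ℝ (fun y => -(bumpKernel y * ⟪y, v⟫)) x v =
      -(bumpKernel x * ‖v‖ ^ 2 + ⟪v, x⟫ * fderiv ℝ bumpKernel x v) := by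
    have hinner : HasFDerivAt (fun y : E => ⟪y, v⟫) ((innerSL ℝ) v) x := by
      refine ((innerSL ℝ) v).hasFDerivAt.congr_of_eventuallyEq (.of_forall fun y => ?_)
      exact real_inner_comm v y
    rw [(hK.hasFDerivAt.fun_mul hinner).fun_neg.fderiv]
    simp [real_inner_comm]
  have hsum (L : E →L[ℝ] ℝ) : ∑ i, ⟪b i, x⟫ * L (b i) = L x := by
    conv_rhs => rw [← b.sum_repr' x]
    simp
  rw [laplacian_eq_sum_fderiv_fderiv hΨ b]
  simp only [fderiv_bumpPotential, hpartial, b.norm_eq_one, Finset.sum_neg_distrib,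
    Finset.sum_add_distrib, hsum]
  simp

lemma laplacian_dilate {g : E → ℝ} (hg : ContDiff ℝ 2 g) (r : ℝ) (x : E) :
    (Δ (dilate r g)) x = (r ^ finrank ℝ E)⁻¹ * (r⁻¹ ^ 2 * (Δ g) (r⁻¹ • x)) := by
  have hcomp : ContDiff ℝ 2 fun y => g (r⁻¹ • y) := hg.comp (contDiff_const_smul _)
  have hsmul := laplacian_comp_add_smul hg 0 r⁻¹ x
  simp only [zero_add, smul_eq_mul] at hsmul
  rw [← hsmul]
  exact InnerProductSpace.laplacian_smul (r ^ finrank ℝ E)⁻¹ hcomp.contDiffAt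

lemma hasDerivAt_dilate_bumpKernel {r : ℝ} (hr : 0 < r) (x : E) :
    HasDerivAt (fun r => dilate r bumpKernel x) (r * (Δ (dilate r bumpPotential : E → ℝ)) x) r := by
  have hK : DifferentiableAt ℝ (bumpKernel : E → ℝ) (r⁻¹ • x) :=
    contDiff_bumpKernel.differentiable (by simp) _
  have hΨ : ContDiff ℝ 2 (bumpPotential : E → ℝ) := contDiff_infty.mp contDiff_bumpPotential 2
  have hinv : HasDerivAt (fun r : ℝ => (r ^ finrank ℝ E)⁻¹)
      (-(finrank ℝ E / r) * (r ^ finrank ℝ E)⁻¹) r := by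
    refine ((hasDerivAt_pow (finrank ℝ E) r).fun_inv (by positivity)).congr_deriv ?_
    rcases Nat.eq_zero_or_pos (finrank ℝ E) with h | h
    · simp [h]
    · rw [← Nat.sub_add_cancel h]
      simp only [Nat.succ_eq_add_one, zero_add, Nat.cast_add, Nat.cast_one, add_tsub_cancel_right,
        pow_succ, pow_zero, one_mul, mul_inv_rev, neg_mul]
      field_simp
  have hsmul := hK.hasFDerivAt.comp_hasDerivAt r ((hasDerivAt_inv hr.ne').smul_const x)
  refine (hinv.mul hsmul).congr_deriv ?_
  rw [laplacian_dilate hΨ, laplacian_bumpPotential]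
  simp only [neg_mul, Function.comp_apply, neg_smul, map_neg, map_smul, smul_eq_mul, mul_neg,
    inv_pow, neg_add_rev]
  field_simp
  ring

end Kernel

section Poisson

variable {E : Type*} [NormedAddCommGroup E] [InnerProductSpace ℝ E] [FiniteDimensional ℝ E]
  [MeasurableSpace E] [BorelSpace E] {u f g : E → ℝ} {Ω : Set E}

lemma integrable_mul_comp_sub (hu : LocallyIntegrable u) (hg : Continuous g)
    (hgc : HasCompactSupport g) (x : E) : Integrable fun y => u y * g (x - y) :=
  (hgc.convolutionExists_right (.lsmul ℝ ℝ) hu hg x).integrable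

lemma fderiv_convolution_apply (hu : LocallyIntegrable u) (hg : ContDiff ℝ 1 g)
    (hgc : HasCompactSupport g) (x v : E) :
    fderiv ℝ (u ⋆ g) x v = (u ⋆ fun y => fderiv ℝ g y v) x := by
  rw [(hgc.hasFDerivAt_convolution_right (.lsmul ℝ ℝ) hu hg x).fderiv]
  exact convolution_precompR_apply (.lsmul ℝ ℝ) hu (hgc.fderiv (𝕜 := ℝ))
    (hg.continuous_fderiv (by simp)) x v

lemma laplacian_convolution (hu : LocallyIntegrable u) (hg : ContDiff ℝ ∞ g)
    (hgc : HasCompactSupport g) (x : E) : (Δ (u ⋆ g)) x = (u ⋆ Δ g) x := by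
  set b := stdOrthonormalBasis ℝ E
  have hpartial (v : E) : ContDiff ℝ ∞ fun y => fderiv ℝ g y v :=
    (hg.fderiv_right (by simp)).clm_apply contDiff_const
  have hconv : ContDiff ℝ ∞ (u ⋆ g) := hgc.contDiff_convolution_right (n := ⊤) _ hu hg
  have hpartial_conv (v : E) :
      (fun x => fderiv ℝ (u ⋆ g) x v) = u ⋆ fun y => fderiv ℝ g y v :=
    funext fun x => fderiv_convolution_apply hu (contDiff_infty.mp hg 1) hgc x v
  have hΔg : Δ g = fun y => ∑ i, fderiv ℝ (fun z => fderiv ℝ g z (b i)) y (b i) :=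
    funext (laplacian_eq_sum_fderiv_fderiv (contDiff_infty.mp hg 2) b)
  rw [laplacian_eq_sum_fderiv_fderiv (contDiff_infty.mp hconv 2) b, hΔg]
  simp only [hpartial_conv, convolution_lsmul, Finset.smul_sum, fderiv_convolution_apply hu
    (contDiff_infty.mp (hpartial _) 1) (hgc.fderiv_apply ℝ _)]
  refine (integral_finsetSum _ fun i _ => ?_).symm
  exact integrable_mul_comp_sub hu ((hpartial (b i)).continuous_fderiv (by simp) |>.clm_apply
    continuous_const) ((hgc.fderiv_apply ℝ (b i)).fderiv_apply ℝ (b i)) x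

/-- The locally integrable functions `u` and `f` solve Poisson's equation `-Δ u = f` on `Ω` in the
sense of distributions. -/
structure SolvesPoissonOn (u f : E → ℝ) (Ω : Set E) : Prop where
  locallyIntegrable_left : LocallyIntegrable u
  locallyIntegrable_right : LocallyIntegrable f
  integral_eq : ∀ φ : E → ℝ, ContDiff ℝ ∞ φ → HasCompactSupport φ → tsupport φ ⊆ Ω →
    -∫ x, u x * (Δ φ) x = ∫ x, f x * φ x

lemma SolvesPoissonOn.convolution_laplacian (h : SolvesPoissonOn u f Ω) (hg : ContDiff ℝ ∞ g)
    {r : ℝ} (hgr : tsupport g ⊆ closedBall 0 r) {x : E} (hx : closedBall x r ⊆ Ω) :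
    (u ⋆ Δ g) x = -(f ⋆ g) x := by
  have hsupp : tsupport (fun y => g (x + (-1 : ℝ) • y)) ⊆ closedBall x r := by
    refine (tsupport_comp_subset_preimage g (f := fun y => x + (-1 : ℝ) • y)
      (by fun_prop)).trans fun y hy => ?_
    have : x + (-1 : ℝ) • y ∈ closedBall 0 r := hgr hy
    rwa [neg_one_smul, ← sub_eq_add_neg, mem_closedBall_zero_iff, ← dist_eq_norm,
      ← mem_closedBall'] at this
  have hreflected := h.integral_eq _ (by fun_prop)
    (.of_isClosed_subset (isCompact_closedBall x r) (isClosed_tsupport _) hsupp) (hsupp.trans hx)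
  simp only [laplacian_comp_add_smul (contDiff_infty.mp hg 2)] at hreflected
  simp only [convolution_lsmul, smul_eq_mul]
  simpa [← sub_eq_add_neg, neg_eq_iff_eq_neg] using hreflected

end Poisson

section Mollifier

variable {E : Type*} [NormedAddCommGroup E] [InnerProductSpace ℝ E] [FiniteDimensional ℝ E]
  [MeasurableSpace E] [BorelSpace E] {u f : E → ℝ} {Ω : Set E} {r : ℝ} {x : E}

lemma integral_bumpKernel_pos : 0 < ∫ x : E, bumpKernel x := by
  have hc : HasCompactSupport (bumpKernel : E → ℝ) :=
    .intro (isCompact_closedBall 0 1) fun x hx =>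
      bumpKernel_eq_zero (not_le.mp (mt mem_closedBall_zero_iff.mpr hx)).le
  exact contDiff_bumpKernel.continuous.integral_pos_of_hasCompactSupport_nonneg_nonzero hc
    bumpKernel_nonneg (bumpKernel_pos (x := (0 : E)) (by simp)).ne'

/-- The multiple of `bumpKernel` of integral one, which generates the mollifications. -/
noncomputable def mollifier (x : E) : ℝ := (∫ y : E, bumpKernel y)⁻¹ * bumpKernel x

lemma contDiff_mollifier : ContDiff ℝ ∞ (mollifier : E → ℝ) :=
  contDiff_const.mul contDiff_bumpKernel

lemma mollifier_nonneg (x : E) : 0 ≤ mollifier x :=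
  mul_nonneg (inv_nonneg.mpr integral_bumpKernel_pos.le) (bumpKernel_nonneg x)

lemma mollifier_pos (hx : ‖x‖ < 1) : 0 < mollifier x :=
  mul_pos (inv_pos.mpr integral_bumpKernel_pos) (bumpKernel_pos hx)

lemma mollifier_eq_zero (hx : 1 ≤ ‖x‖) : mollifier x = 0 := by
  rw [mollifier, bumpKernel_eq_zero hx, mul_zero]

lemma integral_mollifier : ∫ x : E, mollifier x = 1 := by
  simp only [mollifier]
  rw [integral_const_mul, inv_mul_cancel₀ integral_bumpKernel_pos.ne']

lemma dilate_mollifier (r : ℝ) (x : E) :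
    dilate r mollifier x = (∫ y : E, bumpKernel y)⁻¹ * dilate r bumpKernel x := by
  simp only [dilate, mollifier, mul_left_comm]

/-- The mollification of `u` at scale `r`. -/
noncomputable def mollify (r : ℝ) (u : E → ℝ) : E → ℝ := u ⋆ dilate r mollifier

lemma mollify_apply (r : ℝ) (u : E → ℝ) (x : E) :
    mollify r u x = ∫ y, u y * dilate r mollifier (x - y) := by
  simp only [mollify, convolution_lsmul, smul_eq_mul]

lemma hasCompactSupport_dilate_mollifier (hr : 0 < r) :
    HasCompactSupport (dilate r mollifier : E → ℝ) :=
  hasCompactSupport_dilate (fun _ => mollifier_eq_zero) hr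

lemma integrable_mul_dilate_mollifier (hu : LocallyIntegrable u) (hr : 0 < r) (x : E) :
    Integrable fun y => u y * dilate r mollifier (x - y) :=
  integrable_mul_comp_sub hu (contDiff_dilate contDiff_mollifier r).continuous
    (hasCompactSupport_dilate_mollifier hr) x

lemma contDiff_mollify (hu : LocallyIntegrable u) (hr : 0 < r) : ContDiff ℝ ∞ (mollify r u) :=
  (hasCompactSupport_dilate_mollifier hr).contDiff_convolution_right (n := ⊤) _ hu
    (contDiff_dilate contDiff_mollifier r)

lemma ae_tendsto_mollify (hu : LocallyIntegrable u) :
    ∀ᵐ x, Tendsto (fun r => mollify r u x) (𝓝[>] 0) (𝓝 (u x)) :=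
  ae_tendsto_convolution_dilate hu contDiff_mollifier.continuous (fun _ => mollifier_eq_zero)
    integral_mollifier

lemma SolvesPoissonOn.laplacian_mollify (h : SolvesPoissonOn u f Ω) (hr : 0 < r)
    (hx : closedBall x r ⊆ Ω) : (Δ (mollify r u)) x = -mollify r f x := by
  have hg : ContDiff ℝ ∞ (dilate r mollifier : E → ℝ) := contDiff_dilate contDiff_mollifier r
  rw [mollify, laplacian_convolution h.locallyIntegrable_left hg
    (hasCompactSupport_dilate_mollifier hr)]
  exact h.convolution_laplacian hg (tsupport_dilate_subset (fun _ => mollifier_eq_zero) hr) hx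

lemma ae_nonneg_mul_dilate {g : E → ℝ} (hg : ∀ x, 0 ≤ g x) (hg0 : ∀ x, 1 ≤ ‖x‖ → g x = 0)
    (hr : 0 < r) (hu : ∀ᵐ y, y ∈ ball x r → 0 ≤ u y) :
    ∀ᵐ y, 0 ≤ u y * dilate r g (x - y) := by
  filter_upwards [hu] with y hy
  by_cases hyr : y ∈ ball x r
  · exact mul_nonneg (hy hyr) (dilate_nonneg hg hr _)
  · rw [mem_ball', not_lt, dist_eq_norm] at hyr
    rw [dilate_eq_zero hg0 hr hyr, mul_zero]

lemma mollify_nonneg (hr : 0 < r) (hu : ∀ᵐ y, y ∈ ball x r → 0 ≤ u y) : 0 ≤ mollify r u x := by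
  rw [mollify_apply]
  exact integral_nonneg_of_ae (ae_nonneg_mul_dilate mollifier_nonneg (fun _ => mollifier_eq_zero)
    hr hu)

lemma ae_eq_zero_of_mollify_eq_zero (hul : LocallyIntegrable u) (hr : 0 < r)
    (hu : ∀ᵐ y, y ∈ ball x r → 0 ≤ u y) (h0 : mollify r u x = 0) :
    ∀ᵐ y, y ∈ ball x r → u y = 0 := by
  rw [mollify_apply, integral_eq_zero_iff_of_nonneg_ae (ae_nonneg_mul_dilate mollifier_nonneg
    (fun _ => mollifier_eq_zero) hr hu) (integrable_mul_dilate_mollifier hul hr x)] at h0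
  filter_upwards [h0] with y hy hyr
  rw [mem_ball', dist_eq_norm] at hyr
  exact (mul_eq_zero.mp hy).resolve_right (dilate_pos (fun _ => mollifier_pos) hr hyr).ne'

lemma mollify_pos (hul : LocallyIntegrable u) (hr : 0 < r)
    (hu : ∀ᵐ y, y ∈ ball x r → 0 ≤ u y) (hu0 : ¬ ∀ᵐ y, y ∈ ball x r → u y = 0) :
    0 < mollify r u x :=
  (mollify_nonneg hr hu).lt_of_ne' (mt (ae_eq_zero_of_mollify_eq_zero hul hr hu) hu0)

lemma mollify_pos_of_ae_pos (hul : LocallyIntegrable u) (hr : 0 < r)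
    (hu : ∀ᵐ y, y ∈ ball x r → 0 < u y) : 0 < mollify r u x := by
  refine mollify_pos hul hr (hu.mono fun y hy hyx => (hy hyx).le) fun h0 =>
    (measure_ball_pos volume x hr).ne' (measure_eq_zero_iff_ae_notMem.mpr ?_)
  filter_upwards [hu, h0] with y hy hy0 hyx using (hy hyx).ne' (hy0 hyx)

end Mollifier

section LocalToGlobal

variable {X : Type*} [TopologicalSpace X] [SecondCountableTopology X] [MeasurableSpace X]
  {μ : Measure X} {Ω : Set X} {P Q : X → Prop}

lemma ae_of_forall_exists_mem_nhds (h : ∀ x ∈ Ω, ∃ U ∈ 𝓝 x, ∀ᵐ y ∂μ, y ∈ U → P y) :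
    ∀ᵐ x ∂μ, x ∈ Ω → P x := by
  have hnull : μ {x | x ∈ Ω ∧ ¬ P x} = 0 := by
    refine measure_null_of_locally_null _ fun x hx => ?_
    obtain ⟨U, hU, hUP⟩ := h x hx.1
    refine ⟨U ∩ {x | x ∈ Ω ∧ ¬ P x},
      inter_mem (mem_nhdsWithin_of_mem_nhds hU) self_mem_nhdsWithin, ?_⟩
    exact measure_mono_null (fun y hy (h : y ∈ U → P y) => hy.2.2 (h hy.1)) (ae_iff.mp hUP)
  filter_upwards [measure_eq_zero_iff_ae_notMem.mp hnull] with x hx hxΩ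
  exact not_not.mp fun h => hx ⟨hxΩ, h⟩

lemma ae_or_ae_of_isPreconnected [OpensMeasurableSpace X] [μ.IsOpenPosMeasure]
    (hΩ : IsPreconnected Ω) (hPQ : ∀ x, P x → ¬ Q x)
    (hlocal : ∀ x ∈ Ω, ∃ U ∈ 𝓝 x, (∀ᵐ y ∂μ, y ∈ U → P y) ∨ ∀ᵐ y ∂μ, y ∈ U → Q y) :
    (∀ᵐ x ∂μ, x ∈ Ω → P x) ∨ ∀ᵐ x ∂μ, x ∈ Ω → Q x := by
  have isOpen_setOf (R : X → Prop) : IsOpen {x | ∃ U ∈ 𝓝 x, ∀ᵐ y ∂μ, y ∈ U → R y} := by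
    refine isOpen_iff_mem_nhds.mpr fun x ⟨U, hU, hR⟩ => ?_
    filter_upwards [eventually_mem_nhds_iff.mpr hU] with y hy using ⟨U, hy, hR⟩
  have hcover : Ω ⊆ {x | ∃ U ∈ 𝓝 x, ∀ᵐ y ∂μ, y ∈ U → P y} ∪
      {x | ∃ U ∈ 𝓝 x, ∀ᵐ y ∂μ, y ∈ U → Q y} := fun x hx => by
    obtain ⟨U, hU, hPQ⟩ := hlocal x hx
    exact hPQ.imp (⟨U, hU, ·⟩) (⟨U, hU, ·⟩)
  refine (isPreconnected_iff_subset_of_disjoint.mp hΩ _ _ (isOpen_setOf P) (isOpen_setOf Q)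
    hcover ?_).imp (ae_of_forall_exists_mem_nhds ·) (ae_of_forall_exists_mem_nhds ·)
  rw [← disjoint_iff_inter_eq_empty]
  refine disjoint_left.mpr fun x _ => ?_
  rintro ⟨⟨U, hU, hPU⟩, W, hW, hQW⟩
  refine (Measure.measure_pos_of_mem_nhds μ (inter_mem hU hW)).ne'
    (measure_eq_zero_iff_ae_notMem.mpr ?_)
  filter_upwards [hPU, hQW] with y hPy hQy hy using hPQ y (hPy hy.1) (hQy hy.2)

end LocalToGlobal

section MinimumPrinciple

variable {E : Type*} [NormedAddCommGroup E] [InnerProductSpace ℝ E] [FiniteDimensional ℝ E]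
  [MeasurableSpace E] [BorelSpace E] {u f k : E → ℝ} {Ω : Set E} {r : ℝ} {x : E}

lemma hasDerivAt_convolution_right_with_param {K : ℝ → E → ℝ} {S : Set ℝ} {C : Set E}
    (hS : IsOpen S) (hC : IsCompact C) (hK0 : ∀ s y, s ∈ S → y ∉ C → K s y = 0)
    (hu : LocallyIntegrable u) (hK : ContDiffOn ℝ 1 ↿K (S ×ˢ univ)) (hr : r ∈ S)
    (hk : ∀ y, HasDerivAt (fun s => K s y) (k y) r) (x : E) :
    HasDerivAt (fun s => (u ⋆ K s) x) ((u ⋆ k) x) r := by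
  have hSE : IsOpen (S ×ˢ (univ : Set E)) := hS.prod isOpen_univ
  have hderiv := (hasFDerivAt_convolution_right_with_param (.lsmul ℝ ℝ) hS hC hK0 hu hK
    (r, x) hr).comp_hasDerivAt r ((hasDerivAt_id r).prodMk (hasDerivAt_const r x))
  have hsupp : HasCompactSupport fun y => fderiv ℝ ↿K (r, y) := by
    refine .intro hC fun y hy => ?_
    have hK0' : ↿K =ᶠ[𝓝 (r, y)] fun _ => 0 :=
      eventually_of_mem ((hS.prod hC.isClosed.isOpen_compl).mem_nhds ⟨hr, hy⟩)
        fun p hp => hK0 p.1 p.2 hp.1 hp.2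
    rw [hK0'.fderiv_eq, fderiv_fun_const, Pi.zero_apply]
  have hcont : Continuous fun y => fderiv ℝ ↿K (r, y) :=
    (hK.continuousOn_fderiv_of_isOpen hSE le_rfl).comp_continuous (by fun_prop)
      fun y => ⟨hr, mem_univ y⟩
  have hpartial (y : E) : fderiv ℝ ↿K (r, y) (1, 0) = k y := by
    have hKr : HasFDerivAt ↿K (fderiv ℝ ↿K (r, y)) (r, y) :=
      ((hK.contDiffAt (hSE.mem_nhds ⟨hr, mem_univ y⟩)).differentiableAt (by simp)).hasFDerivAt
    exact (hKr.comp_hasDerivAt (f := fun s => (s, y)) r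
      ((hasDerivAt_id r).prodMk (hasDerivAt_const r y))).unique (hk y)
  refine hderiv.congr_deriv ?_
  refine (convolution_precompR_apply (.lsmul ℝ ℝ) hu hsupp hcont x (1, 0)).trans ?_
  simp only [hpartial]

lemma hasDerivAt_convolution_dilate_bumpKernel (hu : LocallyIntegrable u) (hr : 0 < r) (x : E) :
    HasDerivAt (fun r => (u ⋆ dilate r bumpKernel) x)
      (r * (u ⋆ Δ (dilate r bumpPotential : E → ℝ)) x) r := by
  have hzero : ∀ s y, s ∈ Ioo 0 (2 * r) → y ∉ closedBall (0 : E) (2 * r) →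
      dilate s bumpKernel y = 0 := by
    intro s y hs hy
    rw [mem_closedBall_zero_iff, not_le] at hy
    exact dilate_eq_zero (fun _ => bumpKernel_eq_zero) hs.1 (hs.2.trans hy).le
  refine (hasDerivAt_convolution_right_with_param isOpen_Ioo (isCompact_closedBall _ _) hzero hu
    ((contDiffOn_uncurry_dilate (contDiff_infty.mp contDiff_bumpKernel 1)).mono
      (prod_mono_left Ioo_subset_Ioi_self)) ⟨hr, by linarith⟩
    (hasDerivAt_dilate_bumpKernel hr) x).congr_deriv ?_
  simp only [convolution_lsmul, smul_eq_mul, mul_left_comm (u _), integral_const_mul]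

-- The derivative in `r` is a negative multiple of `r (f ⋆ dilate r bumpPotential)(x) ≥ 0`.
lemma SolvesPoissonOn.antitoneOn_mollify (h : SolvesPoissonOn u f Ω)
    (hf : ∀ᵐ y, y ∈ Ω → 0 ≤ f y) {R : ℝ} (hx : closedBall x R ⊆ Ω) :
    AntitoneOn (fun r => mollify r u x) (Ioc 0 R) := by
  have hderiv (r : ℝ) (hr : 0 < r) := (hasDerivAt_convolution_dilate_bumpKernel
    h.locallyIntegrable_left hr x).const_mul (∫ y : E, bumpKernel y)⁻¹
  have hmollify (r : ℝ) : mollify r u x =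
      (∫ y : E, bumpKernel y)⁻¹ * (u ⋆ dilate r bumpKernel) x := by
    simp only [mollify_apply, convolution_lsmul, smul_eq_mul, dilate_mollifier,
      mul_left_comm (u _), integral_const_mul]
  simp only [hmollify]
  refine antitoneOn_of_deriv_nonpos (convex_Ioc 0 R)
    (fun r hr => (hderiv r hr.1).continuousAt.continuousWithinAt)
    (fun r hr => (hderiv r (interior_subset hr).1).differentiableAt.differentiableWithinAt)
    fun r hr => ?_
  obtain ⟨hr0, hrR⟩ := interior_subset hr
  have hxr : closedBall x r ⊆ Ω := (closedBall_subset_closedBall hrR).trans hx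
  have hconv : 0 ≤ (f ⋆ dilate r bumpPotential) x := by
    simp only [convolution_lsmul, smul_eq_mul]
    refine integral_nonneg_of_ae (ae_nonneg_mul_dilate bumpPotential_nonneg
      (fun _ => bumpPotential_eq_zero) hr0
      (hf.mono fun y hy hyr => hy (hxr (ball_subset_closedBall hyr))))
  rw [(hderiv r hr0).deriv, h.convolution_laplacian (contDiff_dilate contDiff_bumpPotential r)
    (tsupport_dilate_subset (fun _ => bumpPotential_eq_zero) hr0) hxr, mul_neg, mul_neg]
  have := integral_bumpKernel_pos (E := E)
  exact neg_nonpos.mpr (by positivity)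

lemma SolvesPoissonOn.ae_mollify_le (h : SolvesPoissonOn u f Ω)
    (hf : ∀ᵐ y, y ∈ Ω → 0 ≤ f y) :
    ∀ᵐ x, ∀ r, 0 < r → closedBall x r ⊆ Ω → mollify r u x ≤ u x := by
  filter_upwards [ae_tendsto_mollify h.locallyIntegrable_left] with x hx r hr hxr
  refine ge_of_tendsto hx ?_
  filter_upwards [Ioc_mem_nhdsGT hr] with s hs
  exact h.antitoneOn_mollify hf hxr hs ⟨hr, le_rfl⟩ hs.2

lemma SolvesPoissonOn.ae_eq_zero_or_pos_on_ball (h : SolvesPoissonOn u f Ω)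
    (hf : ∀ᵐ y, y ∈ Ω → 0 ≤ f y) (hu : ∀ᵐ y, y ∈ Ω → 0 ≤ u y) (hr : 0 < r)
    (hx : closedBall x (3 * r) ⊆ Ω) :
    (∀ᵐ y, y ∈ ball x r → u y = 0) ∨ ∀ᵐ y, y ∈ ball x r → 0 < u y := by
  refine or_iff_not_imp_left.mpr fun hne => ?_
  filter_upwards [h.ae_mollify_le hf] with z hz hzx
  have hzΩ : closedBall z (2 * r) ⊆ Ω :=
    (closedBall_subset_closedBall' (by rw [mem_ball] at hzx; linarith)).trans hx
  have hnonneg : ∀ᵐ y, y ∈ ball z (2 * r) → 0 ≤ u y :=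
    hu.mono fun y hy hyz => hy (hzΩ (ball_subset_closedBall hyz))
  refine (mollify_pos h.locallyIntegrable_left (by positivity) hnonneg
    (mt (fun h0 => ?_) hne)).trans_le (hz (2 * r) (by positivity) hzΩ)
  exact h0.mono fun y hy hyx => hy (ball_subset_ball' (by rw [mem_ball'] at hzx; linarith) hyx)

theorem SolvesPoissonOn.ae_eq_zero_or_pos (h : SolvesPoissonOn u f Ω) (hΩ : IsOpen Ω)
    (hΩc : IsPreconnected Ω) (hf : ∀ᵐ y, y ∈ Ω → 0 ≤ f y) (hu : ∀ᵐ y, y ∈ Ω → 0 ≤ u y) :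
    (∀ᵐ y, y ∈ Ω → u y = 0) ∨ ∀ᵐ y, y ∈ Ω → 0 < u y := by
  refine ae_or_ae_of_isPreconnected hΩc (fun y h0 hpos => hpos.ne' h0) fun x hx => ?_
  obtain ⟨r, hr, hxr⟩ := nhds_basis_closedBall.mem_iff.mp (hΩ.mem_nhds hx)
  exact ⟨ball x (r / 3), ball_mem_nhds x (by positivity), h.ae_eq_zero_or_pos_on_ball hf hu
    (by positivity) (by rwa [mul_div_cancel₀ r three_ne_zero])⟩

end MinimumPrinciple

section AllegrettoPiepenbrinck

lemma integrable_and_integral_le_of_tendsto {X : Type*} [MeasurableSpace X] {μ : Measure X}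
    {F : ℕ → X → ℝ} {f : X → ℝ} {C : ℝ} (hF : ∀ k, Integrable (F k) μ) (hF0 : ∀ k, 0 ≤ᵐ[μ] F k)
    (hFC : ∀ k, ∫ x, F k x ∂μ ≤ C) (hf : ∀ᵐ x ∂μ, Tendsto (F · x) atTop (𝓝 (f x))) :
    Integrable f μ ∧ ∫ x, f x ∂μ ≤ C := by
  have hC : 0 ≤ C := (integral_nonneg_of_ae (hF0 0)).trans (hFC 0)
  have hnorm : eLpNorm f 1 μ ≤ ENNReal.ofReal C := by
    refine Lp.eLpNorm_le_of_ae_tendsto (.of_forall fun k => ?_) (hF · |>.aestronglyMeasurable) hf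
    rw [eLpNorm_one_eq_lintegral_enorm,
      lintegral_congr_ae ((hF0 k).mono fun x hx => Real.enorm_of_nonneg hx),
      ← ofReal_integral_eq_lintegral_ofReal (hF k) (hF0 k)]
    exact ENNReal.ofReal_le_ofReal (hFC k)
  refine ⟨memLp_one_iff_integrable.mp
    ⟨aestronglyMeasurable_of_tendsto_ae _ (hF · |>.aestronglyMeasurable) hf,
      hnorm.trans_lt ENNReal.ofReal_lt_top⟩, (Real.le_norm_self _).trans ?_⟩
  rw [← ENNReal.ofReal_le_ofReal_iff hC, ofReal_norm]
  rw [eLpNorm_one_eq_lintegral_enorm] at hnorm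
  exact (enorm_integral_le_lintegral_enorm f).trans hnorm

variable {E : Type*} [NormedAddCommGroup E] [InnerProductSpace ℝ E] [FiniteDimensional ℝ E]
  [MeasurableSpace E] [BorelSpace E] {u f φ : E → ℝ} {Ω : Set E} {r : ℝ}

lemma SolvesPoissonOn.integral_sq_div_mollify_mul_le (h : SolvesPoissonOn u f Ω)
    (hf : ∀ᵐ y, y ∈ Ω → 0 ≤ f y) (hu : ∀ᵐ y, y ∈ Ω → 0 < u y) (hφ : ContDiff ℝ 1 φ)
    (hφc : HasCompactSupport φ) (hr : 0 < r) (hball : ∀ x ∈ tsupport φ, closedBall x r ⊆ Ω) :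
    Integrable (fun x => φ x ^ 2 / mollify r u x * mollify r f x) ∧
      (∀ x, 0 ≤ φ x ^ 2 / mollify r u x * mollify r f x) ∧
      ∫ x, φ x ^ 2 / mollify r u x * mollify r f x ≤ ∫ x, ‖fderiv ℝ φ x‖ ^ 2 := by
  have hpos : ∀ x ∈ tsupport φ, 0 < mollify r u x := fun x hx =>
    mollify_pos_of_ae_pos h.locallyIntegrable_left hr
      (hu.mono fun y hy hyx => hy (hball x hx (ball_subset_closedBall hyx)))
  have hw : ContDiff ℝ ∞ (mollify r u) := contDiff_mollify h.locallyIntegrable_left hr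
  refine ⟨?_, fun x => ?_, ?_⟩
  · refine ((contDiff_sq_div hφ (contDiff_infty.mp hw 1) hpos).continuous.mul
      (contDiff_mollify h.locallyIntegrable_right hr).continuous).integrable_of_hasCompactSupport
        (hφc.mono fun x hx h0 => hx ?_)
    simp [h0]
  · by_cases hx : x ∈ tsupport φ
    · exact mul_nonneg (div_nonneg (sq_nonneg _) (hpos x hx).le) (mollify_nonneg hr
        (hf.mono fun y hy hyx => hy (hball x hx (ball_subset_closedBall hyx))))
    · simp [image_eq_zero_of_notMem_tsupport hx]
  · refine (integral_congr_ae (.of_forall fun x => ?_)).trans_le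
      (integral_sq_div_mul_neg_laplacian_le hφ hφc (contDiff_infty.mp hw 2) hpos)
    by_cases hx : x ∈ tsupport φ
    · simp [h.laplacian_mollify hr (hball x hx)]
    · simp [image_eq_zero_of_notMem_tsupport hx]

theorem SolvesPoissonOn.integral_sq_div_mul_le (h : SolvesPoissonOn u f Ω) (hΩ : IsOpen Ω)
    (hf : ∀ᵐ y, y ∈ Ω → 0 ≤ f y) (hu : ∀ᵐ y, y ∈ Ω → 0 < u y) (hφ : ContDiff ℝ 1 φ)
    (hφc : HasCompactSupport φ) (hφΩ : tsupport φ ⊆ Ω) :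
    Integrable (fun x => φ x ^ 2 / u x * f x) ∧
      ∫ x, φ x ^ 2 / u x * f x ≤ ∫ x, ‖fderiv ℝ φ x‖ ^ 2 := by
  obtain ⟨δ, hδ, hδΩ⟩ := hφc.isCompact.exists_cthickening_subset_open hΩ hφΩ
  set r : ℕ → ℝ := fun k => δ * (k + 1 : ℝ)⁻¹
  have hr (k : ℕ) : 0 < r k := by positivity
  have hr0 : Tendsto r atTop (𝓝[>] 0) := by
    refine tendsto_nhdsWithin_iff.mpr ⟨?_, .of_forall hr⟩
    simpa [r] using (tendsto_one_div_add_atTop_nhds_zero_nat (𝕜 := ℝ)).const_mul δ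
  have hball (k : ℕ) : ∀ x ∈ tsupport φ, closedBall x (r k) ⊆ Ω := fun x hx =>
    (closedBall_subset_cthickening hx _).trans ((cthickening_mono
      (mul_le_of_le_one_right hδ.le (inv_le_one_of_one_le₀ (by simp))) _).trans hδΩ)
  have hmollify (k : ℕ) := h.integral_sq_div_mollify_mul_le hf hu hφ hφc (hr k) (hball k)
  refine integrable_and_integral_le_of_tendsto (fun k => (hmollify k).1)
    (fun k => .of_forall (hmollify k).2.1) (fun k => (hmollify k).2.2) ?_
  filter_upwards [ae_tendsto_mollify h.locallyIntegrable_left,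
    ae_tendsto_mollify h.locallyIntegrable_right, hu] with x hux hfx hpos
  by_cases hx : x ∈ tsupport φ
  · exact (tendsto_const_nhds.div (hux.comp hr0) (hpos (hφΩ hx)).ne').mul (hfx.comp hr0)
  · simp [image_eq_zero_of_notMem_tsupport hx]

end AllegrettoPiepenbrinck

section ConeLiouville

variable {E : Type*} [NormedAddCommGroup E] [InnerProductSpace ℝ E] [FiniteDimensional ℝ E]
  [MeasurableSpace E] [BorelSpace E] {V u φ : E → ℝ} {Ω : Set E} {α : ℝ}

theorem SolvesPoissonOn.integral_sq_mul_potential_le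
    (h : SolvesPoissonOn u (fun x => V x * u x) Ω) (hΩ : IsOpen Ω) (hV : ∀ x ∈ Ω, 0 ≤ V x)
    (hu : ∀ᵐ x, x ∈ Ω → 0 < u x) (hφ : ContDiff ℝ 1 φ) (hφc : HasCompactSupport φ)
    (hφΩ : tsupport φ ⊆ Ω) :
    Integrable (fun x => φ x ^ 2 * V x) ∧ ∫ x, φ x ^ 2 * V x ≤ ∫ x, ‖fderiv ℝ φ x‖ ^ 2 := by
  have hcancel : (fun x => φ x ^ 2 / u x * (V x * u x)) =ᵐ[volume] fun x => φ x ^ 2 * V x := by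
    filter_upwards [hu] with x hx
    by_cases hxΩ : x ∈ Ω
    · have := (hx hxΩ).ne'
      field
    · simp [image_eq_zero_of_notMem_tsupport fun hxφ => hxΩ (hφΩ hxφ)]
  rw [← integrable_congr hcancel, ← integral_congr_ae hcancel]
  exact h.integral_sq_div_mul_le hΩ
    (hu.mono fun x hx hxΩ => mul_nonneg (hV x hxΩ) (hx hxΩ).le) hu hφ hφc hφΩ

lemma integral_norm_fderiv_comp_inv_smul_sq (φ : E → ℝ) {t : ℝ} (ht : 0 < t) :
    ∫ x, ‖fderiv ℝ (fun y => φ (t⁻¹ • y)) x‖ ^ 2 =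
      t ^ finrank ℝ E * (t⁻¹ ^ 2 * ∫ x, ‖fderiv ℝ φ x‖ ^ 2) := by
  simp only [fderiv_comp_smul, norm_smul, mul_pow, Real.norm_eq_abs, sq_abs]
  rw [Measure.integral_comp_inv_smul_of_nonneg volume
    (fun x => t⁻¹ ^ 2 * ‖fderiv ℝ φ x‖ ^ 2) ht.le, integral_const_mul, smul_eq_mul]

lemma integral_comp_inv_smul_sq_mul (hφΩ : tsupport φ ⊆ Ω) {t : ℝ} (ht : 0 < t)
    (hVt : ∀ x ∈ Ω, V (t • x) = t ^ α * V x) :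
    ∫ x, φ (t⁻¹ • x) ^ 2 * V x = t ^ finrank ℝ E * (t ^ α * ∫ x, φ x ^ 2 * V x) := by
  have hscale (x : E) : φ x ^ 2 * V (t • x) = t ^ α * (φ x ^ 2 * V x) := by
    by_cases hx : x ∈ tsupport φ
    · rw [hVt x (hφΩ hx), mul_left_comm]
    · simp [image_eq_zero_of_notMem_tsupport hx]
  have := Measure.integral_comp_inv_smul_of_nonneg volume (fun x => φ x ^ 2 * V (t • x)) ht.le
  simpa only [smul_inv_smul₀ ht.ne', hscale, integral_const_mul, smul_eq_mul] using this

lemma SolvesPoissonOn.rpow_mul_integral_sq_mul_potential_le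
    (h : SolvesPoissonOn u (fun x => V x * u x) Ω) (hΩ : IsOpen Ω) (hV : ∀ x ∈ Ω, 0 ≤ V x)
    (hu : ∀ᵐ x, x ∈ Ω → 0 < u x) (hφ : ContDiff ℝ 1 φ) (hφc : HasCompactSupport φ)
    (hφΩ : tsupport φ ⊆ Ω) {t : ℝ} (ht : 0 < t) (hΩt : ∀ x ∈ Ω, t • x ∈ Ω)
    (hVt : ∀ x ∈ Ω, V (t • x) = t ^ α * V x) :
    t ^ (α + 2) * ∫ x, φ x ^ 2 * V x ≤ ∫ x, ‖fderiv ℝ φ x‖ ^ 2 := by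
  have hsupp : tsupport (fun x => φ (t⁻¹ • x)) ⊆ Ω := fun x hx => by
    have hxφ := hφΩ (tsupport_comp_subset_preimage φ (continuous_const_smul t⁻¹) hx)
    simpa only [smul_inv_smul₀ ht.ne'] using hΩt _ hxφ
  have hle := (h.integral_sq_mul_potential_le (φ := fun x => φ (t⁻¹ • x)) hΩ hV hu
    (hφ.comp (contDiff_const_smul t⁻¹)) (hφc.comp_smul (inv_ne_zero ht.ne')) hsupp).2
  rw [integral_norm_fderiv_comp_inv_smul_sq φ ht, integral_comp_inv_smul_sq_mul hφΩ ht hVt] at hle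
  have hscaled := le_of_mul_le_mul_left hle (by positivity)
  rw [inv_pow, ← div_eq_inv_mul, le_div_iff₀ (by positivity)] at hscaled
  rwa [Real.rpow_add ht, Real.rpow_two, mul_right_comm]

lemma SolvesPoissonOn.not_ae_pos_of_homogeneous
    (h : SolvesPoissonOn u (fun x => V x * u x) Ω) (hΩ : IsOpen Ω) (hΩne : Ω.Nonempty)
    (hΩt : ∀ t : ℝ, 1 ≤ t → ∀ x ∈ Ω, t • x ∈ Ω) (hα : -2 < α) (hV : ∀ x ∈ Ω, 0 < V x)
    (hVt : ∀ t : ℝ, 1 ≤ t → ∀ x ∈ Ω, V (t • x) = t ^ α * V x) :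
    ¬ ∀ᵐ x, x ∈ Ω → 0 < u x := by
  intro hpos
  obtain ⟨x₀, hx₀⟩ := hΩne
  obtain ⟨φ, hφΩ, hφc, hφ, -, hφx₀⟩ := exists_contDiff_tsupport_subset (n := 1) (hΩ.mem_nhds hx₀)
  have hV0 : ∀ x ∈ Ω, 0 ≤ V x := fun x hx => (hV x hx).le
  have hI : 0 < ∫ x, φ x ^ 2 * V x := by
    have hφV (x : E) (hx : φ x ≠ 0) : 0 < V x := hV x (hφΩ (subset_tsupport φ hx))
    have hnonneg : 0 ≤ fun x => φ x ^ 2 * V x := fun x => by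
      by_cases hx : φ x = 0
      · simp [hx]
      · exact mul_nonneg (sq_nonneg _) (hφV x hx).le
    rw [integral_pos_iff_support_of_nonneg hnonneg
      (h.integral_sq_mul_potential_le hΩ hV0 hpos hφ hφc hφΩ).1]
    exact (hφ.continuous.isOpen_support.measure_pos volume ⟨x₀, by simp [hφx₀]⟩).trans_le
      (measure_mono fun x hx => mul_ne_zero (pow_ne_zero 2 hx) (hφV x hx).ne')
  have htop := (tendsto_rpow_atTop (by linarith : 0 < α + 2)).atTop_mul_const hI
  obtain ⟨t, htD, ht⟩ :=
    ((htop.eventually_gt_atTop (∫ x, ‖fderiv ℝ φ x‖ ^ 2)).and (eventually_ge_atTop 1)).exists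
  exact htD.not_ge (h.rpow_mul_integral_sq_mul_potential_le hΩ hV0 hpos hφ hφc hφΩ
    (one_pos.trans_le ht) (hΩt t ht) (hVt t ht))

theorem SolvesPoissonOn.ae_eq_zero_of_nonneg (h : SolvesPoissonOn u (fun x => V x * u x) Ω)
    (hΩ : IsOpen Ω) (hΩc : IsPreconnected Ω) (hΩt : ∀ t : ℝ, 1 ≤ t → ∀ x ∈ Ω, t • x ∈ Ω)
    (hα : -2 < α) (hV : ∀ x ∈ Ω, 0 < V x)
    (hVt : ∀ t : ℝ, 1 ≤ t → ∀ x ∈ Ω, V (t • x) = t ^ α * V x)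
    (hu : ∀ᵐ x, x ∈ Ω → 0 ≤ u x) : ∀ᵐ x, x ∈ Ω → u x = 0 := by
  rcases Ω.eq_empty_or_nonempty with rfl | hΩne
  · simp
  · have hf : ∀ᵐ x, x ∈ Ω → 0 ≤ V x * u x :=
      hu.mono fun x hx hxΩ => mul_nonneg (hV x hxΩ).le (hx hxΩ)
    exact (h.ae_eq_zero_or_pos hΩ hΩc hf hu).resolve_right
      (h.not_ae_pos_of_homogeneous hΩ hΩne hΩt hα hV hVt)

end ConeLiouville

section DilationContinuity

variable {E : Type*} [NormedAddCommGroup E] [NormedSpace ℝ E] [FiniteDimensional ℝ E]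
  [MeasurableSpace E] [BorelSpace E] {μ : Measure E} [μ.IsAddHaarMeasure] {F : Type*}
  [NormedAddCommGroup F] {f g : E → F}

lemma tendsto_integral_norm_comp_smul_sub_of_continuous (hg : Continuous g)
    (hgc : HasCompactSupport g) :
    Tendsto (fun t : ℝ => ∫ x, ‖g (t • x) - g x‖ ∂μ) (𝓝 1) (𝓝 0) := by
  obtain ⟨R, hR, hgR⟩ := hgc.exists_pos_le_norm
  have hcont : ContinuousOn (fun t : ℝ => ∫ x, ‖g (t • x) - g x‖ ∂μ) (Ioi 2⁻¹) := by
    refine continuousOn_integral_of_compact_support (isCompact_closedBall 0 (2 * R))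
      (Continuous.continuousOn (by fun_prop)) fun t x ht hx => ?_
    rw [mem_closedBall_zero_iff, not_le] at hx
    rw [mem_Ioi] at ht
    have htx : R ≤ ‖t • x‖ := by
      rw [norm_smul, Real.norm_of_nonneg (by linarith)]
      nlinarith
    rw [hgR _ htx, hgR x (by linarith), sub_zero, norm_zero]
  simpa using (hcont.continuousAt (Ioi_mem_nhds (by norm_num : (2⁻¹ : ℝ) < 1))).tendsto

theorem tendsto_integral_norm_comp_smul_sub [NormedSpace ℝ F] (hf : Integrable f μ) :
    Tendsto (fun t : ℝ => ∫ x, ‖f (t • x) - f x‖ ∂μ) (𝓝 1) (𝓝 0) := by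
  refine Metric.tendsto_nhds.mpr fun ε hε => ?_
  obtain ⟨g, hgc, hfg, hg, hgi⟩ := hf.exists_hasCompactSupport_integral_sub_le
    (by positivity : 0 < ε / 5)
  have hjac : Tendsto (fun t : ℝ => (t ^ finrank ℝ E)⁻¹) (𝓝 1) (𝓝 1) := by
    simpa using ((continuous_pow (finrank ℝ E)).tendsto (1 : ℝ)).inv₀ (by simp)
  filter_upwards [lt_mem_nhds one_pos, hjac.eventually_lt_const one_lt_two,
    (tendsto_integral_norm_comp_smul_sub_of_continuous (μ := μ) hg hgc).eventually_lt_const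
      (by positivity : 0 < ε / 5)] with t ht htjac htg
  have hdil : ∫ x, ‖f (t • x) - g (t • x)‖ ∂μ = (t ^ finrank ℝ E)⁻¹ * ∫ x, ‖f x - g x‖ ∂μ :=
    Measure.integral_comp_smul_of_nonneg μ (fun x => ‖f x - g x‖) t (hR := ht.le)
  have htri : ∫ x, ‖f (t • x) - f x‖ ∂μ ≤
      (∫ x, ‖f (t • x) - g (t • x)‖ ∂μ) + (∫ x, ‖g (t • x) - g x‖ ∂μ) + ∫ x, ‖f x - g x‖ ∂μ := by
    have hft := hf.comp_smul ht.ne'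
    have hgt := hgi.comp_smul ht.ne'
    have h₁ : Integrable (fun x => ‖f (t • x) - g (t • x)‖) μ := (hft.sub hgt).norm
    have h₂ : Integrable (fun x => ‖g (t • x) - g x‖) μ := (hgt.sub hgi).norm
    have h₃ : Integrable (fun x => ‖f x - g x‖) μ := (hf.sub hgi).norm
    rw [← integral_add h₁ h₂, ← integral_add (h₁.fun_add h₂) h₃]
    refine integral_mono (hft.sub hf).norm ((h₁.fun_add h₂).fun_add h₃) fun x => ?_
    have hsplit : f (t • x) - f x =
        f (t • x) - g (t • x) + (g (t • x) - g x) - (f x - g x) := by abel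
    simp only [hsplit]
    exact (norm_sub_le _ _).trans (add_le_add_left (norm_add_le _ _) _)
  have hfg0 : 0 ≤ ∫ x, ‖f x - g x‖ ∂μ := integral_nonneg fun x => norm_nonneg _
  rw [dist_zero_right, Real.norm_of_nonneg (integral_nonneg fun x => norm_nonneg _)]
  nlinarith

end DilationContinuity

section CompactSupport

variable {E : Type*} [NormedAddCommGroup E] [InnerProductSpace ℝ E] [FiniteDimensional ℝ E]
  [MeasurableSpace E] [BorelSpace E] {V u v f g : E → ℝ} {Ω : Set E} {α M r R t : ℝ}

lemma dilate_mollifier_sub_comm (r : ℝ) (x y : E) :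
    dilate r mollifier (x - y) = dilate r mollifier (y - x) := by
  simp only [dilate, mollifier, bumpKernel, norm_smul, norm_sub_rev x y]

lemma norm_mollify_le (hr : 0 < r) (hu : ∀ᵐ x, ‖u x‖ ≤ M) (x : E) : ‖mollify r u x‖ ≤ M := by
  have hk : Integrable fun y => dilate r mollifier (x - y) :=
    ((contDiff_dilate contDiff_mollifier r).continuous.integrable_of_hasCompactSupport
      (hasCompactSupport_dilate_mollifier hr)).comp_sub_left x
  calc ‖mollify r u x‖ ≤ ∫ y, M * dilate r mollifier (x - y) := by
        rw [mollify_apply]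
        refine norm_integral_le_of_norm_le (hk.const_mul M) (hu.mono fun y hy => ?_)
        have := dilate_nonneg mollifier_nonneg hr (x - y)
        rw [norm_mul, Real.norm_of_nonneg this]
        gcongr
    _ = M := by
        rw [integral_const_mul, integral_sub_left_eq_self (dilate r mollifier) volume x,
          integral_dilate _ hr, integral_mollifier, mul_one]

lemma integral_mul_mollify_comm (hf : Integrable f) (hg : Integrable g) (hr : 0 < r) :
    ∫ x, f x * mollify r g x = ∫ x, g x * mollify r f x := by
  have hk : Continuous (dilate r mollifier : E → ℝ) :=
    (contDiff_dilate contDiff_mollifier r).continuous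
  obtain ⟨B, hB⟩ := hk.bounded_above_of_compact_support (hasCompactSupport_dilate_mollifier hr)
  have hint : Integrable (fun p : E × E => f p.1 * g p.2 * dilate r mollifier (p.1 - p.2))
      (volume.prod volume) :=
    (hf.mul_prod hg).mul_bdd (hk.comp (continuous_fst.sub continuous_snd)).aestronglyMeasurable
      (.of_forall fun p => hB _)
  simp only [mollify_apply, ← integral_const_mul, ← mul_assoc]
  rw [integral_integral_swap hint]
  simp only [dilate_mollifier_sub_comm r _, mul_comm (f _)]

lemma tendsto_integral_mul_mollify (hf : Integrable f) (hu : LocallyIntegrable u)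
    (huM : ∀ᵐ x, ‖u x‖ ≤ M) :
    Tendsto (fun r => ∫ x, f x * mollify r u x) (𝓝[>] 0) (𝓝 (∫ x, f x * u x)) := by
  refine tendsto_integral_filter_of_dominated_convergence (fun x => ‖f x‖ * M) ?_ ?_
    (hf.norm.mul_const M) ?_
  · filter_upwards [self_mem_nhdsWithin] with r hr using
      hf.aestronglyMeasurable.mul (contDiff_mollify hu hr).continuous.aestronglyMeasurable
  · filter_upwards [self_mem_nhdsWithin] with r hr
    refine .of_forall fun x => ?_
    rw [norm_mul]
    gcongr
    exact norm_mollify_le hr huM x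
  · filter_upwards [ae_tendsto_mollify hu] with x hx using hx.const_mul (f x)

lemma hasCompactSupport_mollify (hr : 0 < r) (hu : ∀ᵐ x, R < ‖x‖ → u x = 0) :
    HasCompactSupport (mollify r u) := by
  refine .intro (isCompact_closedBall 0 (R + r)) fun x hx => ?_
  rw [mem_closedBall_zero_iff, not_le] at hx
  rw [mollify_apply]
  refine integral_eq_zero_of_ae (hu.mono fun y hy => ?_)
  by_cases hyr : r ≤ ‖x - y‖
  · simp [dilate_eq_zero (fun _ => mollifier_eq_zero) hr hyr]
  · simp [hy (by linarith [norm_sub_norm_le x y])]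

lemma SolvesPoissonOn.integral_mul_comm (h : SolvesPoissonOn u f univ)
    (hv : SolvesPoissonOn v g univ) (hu : Integrable u) (hf : Integrable f) (hg : Integrable g)
    (huM : ∀ᵐ x, ‖u x‖ ≤ M) (hvM : ∀ᵐ x, ‖v x‖ ≤ M) (hvR : ∀ᵐ x, R < ‖x‖ → v x = 0) :
    ∫ x, f x * v x = ∫ x, g x * u x := by
  have hmollify : ∀ r ∈ Ioi (0 : ℝ), ∫ x, f x * mollify r v x = ∫ x, g x * mollify r u x := by
    intro r hr
    rw [← h.integral_eq _ (contDiff_mollify hv.locallyIntegrable_left hr)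
      (hasCompactSupport_mollify hr hvR) (subset_univ _), ← integral_mul_mollify_comm hu hg hr]
    simp only [hv.laplacian_mollify hr (subset_univ _), mul_neg, integral_neg, neg_neg]
  exact tendsto_nhds_unique
    ((tendsto_integral_mul_mollify hf hv.locallyIntegrable_left hvM).congr'
      (eventually_mem_nhdsWithin.mono hmollify))
    (tendsto_integral_mul_mollify hg h.locallyIntegrable_left huM)

lemma locallyIntegrable_comp_smul (hf : LocallyIntegrable f) (ht : t ≠ 0) :
    LocallyIntegrable fun x => f (t • x) := by
  refine locallyIntegrable_iff.mpr fun K hK => ?_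
  have hint := ((hf.integrableOn_isCompact (hK.smul t)).integrable_indicator
    (hK.smul t).isClosed.measurableSet).comp_smul ht
  exact hint.integrableOn.congr_fun
    (fun x hx => indicator_of_mem (smul_mem_smul_set hx) f) hK.isClosed.measurableSet

lemma SolvesPoissonOn.comp_smul (h : SolvesPoissonOn u f Ω) (ht : 0 < t) :
    SolvesPoissonOn (fun x => u (t • x)) (fun x => t ^ 2 * f (t • x)) ((t • ·) ⁻¹' Ω) where
  locallyIntegrable_left := locallyIntegrable_comp_smul h.locallyIntegrable_left ht.ne'
  locallyIntegrable_right :=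
    (locallyIntegrable_comp_smul h.locallyIntegrable_right ht.ne').smul (t ^ 2)
  integral_eq φ hφ hφc hφΩ := by
    have hsupp : tsupport (fun x => φ (t⁻¹ • x)) ⊆ Ω := fun x hx => by
      have hxφ := hφΩ (tsupport_comp_subset_preimage φ (continuous_const_smul t⁻¹) hx)
      simpa only [mem_preimage, smul_inv_smul₀ ht.ne'] using hxφ
    have heq := h.integral_eq (fun x => φ (t⁻¹ • x)) (hφ.comp (contDiff_const_smul t⁻¹))
      (hφc.comp_smul (inv_ne_zero ht.ne')) hsupp
    have hlap (x : E) : (Δ fun y => φ (t⁻¹ • y)) x = t⁻¹ ^ 2 * (Δ φ) (t⁻¹ • x) := by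
      simpa using laplacian_comp_add_smul (contDiff_infty.mp hφ 2) 0 t⁻¹ x
    have hleft := Measure.integral_comp_smul_of_nonneg volume
      (fun x => u x * (Δ fun y => φ (t⁻¹ • y)) x) t (hR := ht.le)
    have hright := Measure.integral_comp_smul_of_nonneg volume
      (fun x => f x * φ (t⁻¹ • x)) t (hR := ht.le)
    simp only [hlap, inv_smul_smul₀ ht.ne', mul_left_comm (u _), integral_const_mul,
      smul_eq_mul] at hleft hright heq
    simp only [mul_assoc, integral_const_mul, hright, ← heq]
    rw [mul_neg, ← hleft, mul_neg, ← mul_assoc, ← mul_pow, mul_inv_cancel₀ ht.ne', one_pow,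
      one_mul]

lemma integrable_of_ae_eq_zero (hf : LocallyIntegrable f) (hR : ∀ᵐ x, R < ‖x‖ → f x = 0) :
    Integrable f := by
  refine ((hf.integrableOn_isCompact (isCompact_closedBall 0 R)).integrable_indicator
    isClosed_closedBall.measurableSet).congr (hR.mono fun x hx => ?_)
  by_cases hxR : x ∈ closedBall 0 R
  · rw [indicator_of_mem hxR]
  · rw [indicator_of_notMem hxR, hx (by simpa using hxR)]

lemma SolvesPoissonOn.integral_comp_smul_mul_eq_zero
    (h : SolvesPoissonOn u (fun x => V x * u x) univ)
    (huM : ∀ᵐ x, ‖u x‖ ≤ M) (huR : ∀ᵐ x, R < ‖x‖ → u x = 0) (hα : α ≠ -2) (ht : 1 < t)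
    (hVt : ∀ᵐ x, V (t • x) = t ^ α * V x) :
    ∫ x, V (t • x) * u (t • x) * u x = 0 := by
  have ht0 : 0 < t := by positivity
  have hu := integrable_of_ae_eq_zero h.locallyIntegrable_left huR
  have hVu : Integrable fun x => V x * u x :=
    integrable_of_ae_eq_zero (R := R) h.locallyIntegrable_right <|
      huR.mono fun x hx hxR => by rw [hx hxR, mul_zero]
  have hdilate := Measure.quasiMeasurePreserving_smul (volume : Measure E) ht0.ne'
  have hutR : ∀ᵐ x, R < ‖x‖ → u (t • x) = 0 := (hdilate.ae huR).mono fun x hx hxR => hx <| by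
    rw [norm_smul, Real.norm_of_nonneg ht0.le]
    exact hxR.trans_le (le_mul_of_one_le_left (norm_nonneg x) ht.le)
  have hsymm := h.integral_mul_comm (h.comp_smul ht0) hu hVu ((hVu.comp_smul ht0.ne').const_mul _)
    huM (hdilate.ae huM) hutR
  have hhom : ∫ x, V (t • x) * u (t • x) * u x = t ^ α * ∫ x, V x * u x * u (t • x) := by
    rw [← integral_const_mul]
    refine integral_congr_ae (hVt.mono fun x hx => ?_)
    simp only [hx]
    ring
  simp only [mul_assoc (t ^ 2), integral_const_mul] at hsymm
  rw [hsymm, ← mul_assoc, ← Real.rpow_two, ← Real.rpow_add ht0] at hhom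
  have hne : t ^ (α + 2) ≠ 1 := by
    rw [← Real.rpow_zero t, Ne, Real.rpow_right_inj ht0 ht.ne']
    exact fun h0 => hα (by linarith)
  exact (mul_left_eq_self₀.mp hhom.symm).resolve_left hne

theorem SolvesPoissonOn.ae_eq_zero_of_ae_eq_zero_near_infinity
    (h : SolvesPoissonOn u (fun x => V x * u x) univ)
    (huM : ∀ᵐ x, ‖u x‖ ≤ M) (huR : ∀ᵐ x, R < ‖x‖ → u x = 0) (hα : α ≠ -2)
    (hV : ∀ᵐ x, 0 < V x) (hVt : ∀ t : ℝ, 1 < t → ∀ᵐ x, V (t • x) = t ^ α * V x) :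
    ∀ᵐ x, u x = 0 := by
  have hu := integrable_of_ae_eq_zero h.locallyIntegrable_left huR
  have hVu : Integrable fun x => V x * u x :=
    integrable_of_ae_eq_zero (R := R) h.locallyIntegrable_right <|
      huR.mono fun x hx hxR => by rw [hx hxR, mul_zero]
  have hbound (t : ℝ) (ht : t ∈ Ioi 1) :
      ‖∫ x, V x * u x * u x‖ ≤ (∫ x, ‖V (t • x) * u (t • x) - V x * u x‖) * M := by
    have ht0 : t ≠ 0 := (zero_lt_one.trans ht).ne'
    have hVut := hVu.comp_smul ht0
    have hdiff := integral_sub (hVut.mul_bdd hu.aestronglyMeasurable huM)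
      (hVu.mul_bdd hu.aestronglyMeasurable huM)
    rw [h.integral_comp_smul_mul_eq_zero huM huR hα ht (hVt t ht), zero_sub] at hdiff
    rw [← norm_neg, ← hdiff, ← integral_mul_const]
    refine norm_integral_le_of_norm_le ((hVut.sub hVu).norm.mul_const M) (huM.mono fun x hx => ?_)
    rw [← sub_mul, norm_mul]
    gcongr
  have hself : ∫ x, V x * u x * u x = 0 := by
    have hlim := ((tendsto_integral_norm_comp_smul_sub hVu).mono_left
      (nhdsWithin_le_nhds (s := Ioi 1))).mul_const M
    rw [zero_mul] at hlim
    exact norm_le_zero_iff.mp (ge_of_tendsto hlim (eventually_mem_nhdsWithin.mono hbound))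
  have hnonneg : 0 ≤ᵐ[volume] fun x => V x * u x * u x := hV.mono fun x hx => by
    simpa only [mul_assoc, Pi.zero_apply] using mul_nonneg hx.le (mul_self_nonneg (u x))
  rw [integral_eq_zero_iff_of_nonneg_ae hnonneg
    (hVu.mul_bdd hu.aestronglyMeasurable huM)] at hself
  filter_upwards [hself, hV] with x hx hVx
  simpa [hVx.ne'] using hx

end CompactSupport

section SignChange

variable {n : ℕ} {α R : ℝ} {V u : EuclideanSpace ℝ (Fin n) → ℝ}

lemma IsWeakSolution.neg (h : IsWeakSolution V u) : IsWeakSolution V (-u) where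
  locallyIntegrable := h.locallyIntegrable.neg
  locallyIntegrable_mul :=
    h.locallyIntegrable_mul.neg.congr (.of_forall fun x => (mul_neg (V x) (u x)).symm)
  integral_eq φ hφ hφc := by
    simpa only [Pi.neg_apply, neg_mul, mul_neg, integral_neg, neg_inj] using h.integral_eq φ hφ hφc

lemma IsWeakSolution.solvesPoissonOn (h : IsWeakSolution V u)
    (Ω : Set (EuclideanSpace ℝ (Fin n))) : SolvesPoissonOn u (fun x => V x * u x) Ω where
  locallyIntegrable_left := h.locallyIntegrable
  locallyIntegrable_right := h.locallyIntegrable_mul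
  integral_eq φ hφ hφc _ := h.integral_eq φ hφ hφc

lemma IsWeakSolution.ae_eq_zero_of_lt_inner (hsol : IsWeakSolution V u) (hα : -2 < α)
    (hVpos : ∀ x, x ≠ 0 → 0 < V x) (hVhom : IsHomogeneousOfOrder α V) (hR : 0 < R)
    (hu : ∀ᵐ x, R < ‖x‖ → 0 ≤ u x) {v : EuclideanSpace ℝ (Fin n)} (hv : ‖v‖ ≤ 1) :
    ∀ᵐ x, R < ⟪v, x⟫ → u x = 0 := by
  have hnorm {x} (hx : R < ⟪v, x⟫) : R < ‖x‖ := hx.trans_le <|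
    (real_inner_le_norm v x).trans (mul_le_of_le_one_left (norm_nonneg x) hv)
  have hne {x} (hx : R < ⟪v, x⟫) : x ≠ 0 := norm_pos_iff.mp (hR.trans (hnorm hx))
  refine (hsol.solvesPoissonOn {x | R < ⟪v, x⟫}).ae_eq_zero_of_nonneg
    (isOpen_lt continuous_const (by fun_prop))
    (convex_halfSpace_gt (innerₗ _ v).isLinear R).isPreconnected ?_ hα
    (fun x hx => hVpos x (hne hx))
    (fun t ht x hx => hVhom t (one_pos.trans_le ht) x (hne hx))
    (hu.mono fun x hx hxv => hx (hnorm hxv))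
  intro t ht x hx
  calc R < ⟪v, x⟫ := hx
    _ ≤ t * ⟪v, x⟫ := le_mul_of_one_le_left (hR.trans hx).le ht
    _ = ⟪v, t • x⟫ := (inner_smul_right v x t).symm

lemma IsWeakSolution.ae_eq_zero_near_infinity (hsol : IsWeakSolution V u) (hα : -2 < α)
    (hVpos : ∀ x, x ≠ 0 → 0 < V x) (hVhom : IsHomogeneousOfOrder α V) (hR : 0 < R)
    (hu : ∀ᵐ x, R < ‖x‖ → 0 ≤ u x) : ∀ᵐ x, R < ‖x‖ → u x = 0 := by
  refine ae_of_forall_exists_mem_nhds (Ω := {x | R < ‖x‖}) fun x hx => ?_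
  have hv : ‖‖x‖⁻¹ • x‖ = 1 := norm_smul_inv_norm (norm_pos_iff.mp (hR.trans hx))
  have hxv : R < ⟪‖x‖⁻¹ • x, x⟫ := by
    rwa [real_inner_smul_left, real_inner_self_eq_norm_mul_norm,
      inv_mul_cancel_left₀ (hR.trans hx).ne']
  exact ⟨{y | R < ⟪‖x‖⁻¹ • x, y⟫}, (isOpen_lt continuous_const (by fun_prop)).mem_nhds hxv,
    hsol.ae_eq_zero_of_lt_inner hα hVpos hVhom hR hu hv.le⟩

theorem IsWeakSolution.ae_eq_zero_of_nonneg_near_infinity (hsol : IsWeakSolution V u)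
    (hn : 1 ≤ n) (hα : -2 < α) (hVpos : ∀ x, x ≠ 0 → 0 < V x) (hVhom : IsHomogeneousOfOrder α V)
    (hu : MemLp u ∞) (hu0 : ∀ᵐ x, R < ‖x‖ → 0 ≤ u x) : u =ᵐ[volume] 0 := by
  have : Nonempty (Fin n) := ⟨⟨0, hn⟩⟩
  have hne : ∀ᵐ x : EuclideanSpace ℝ (Fin n), x ≠ 0 := Measure.ae_ne volume 0
  have huM : ∀ᵐ x, ‖u x‖ ≤ (eLpNorm u ∞ volume).toReal :=
    (ae_le_eLpNormEssSup (f := u)).mono fun x hx => by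
      rw [← toReal_enorm]
      exact ENNReal.toReal_mono hu.eLpNorm_ne_top (by rwa [eLpNorm_exponent_top])
  have huR := hsol.ae_eq_zero_near_infinity hα hVpos hVhom (lt_max_of_lt_right one_pos)
    (hu0.mono fun x hx hxR => hx ((le_max_left R 1).trans_lt hxR))
  exact (hsol.solvesPoissonOn univ).ae_eq_zero_of_ae_eq_zero_near_infinity huM huR hα.ne'
    (hne.mono hVpos) fun t ht => hne.mono (hVhom t (one_pos.trans ht))

theorem corollary1p5_general (hn : 1 ≤ n) (hα : -2 < α) (hVpos : ∀ x, x ≠ 0 → 0 < V x)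
    (hVhom : IsHomogeneousOfOrder α V) (hu : MemLp u ∞) (hsol : IsWeakSolution V u)
    (hu0 : ¬ u =ᵐ[volume] 0) : ChangesSignNearInfinity u := by
  refine fun R => ⟨fun h => hu0 ?_, fun h => hu0 ?_⟩
  · have hneg := hsol.neg.ae_eq_zero_of_nonneg_near_infinity (R := R) hn hα hVpos hVhom hu.neg <|
      h.mono fun x hx hxR => neg_nonneg.mpr (not_lt.mp fun hpos => hx ⟨hxR, hpos⟩)
    exact hneg.mono fun x hx => neg_eq_zero.mp hx
  · exact hsol.ae_eq_zero_of_nonneg_near_infinity (R := R) hn hα hVpos hVhom hu <|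
      h.mono fun x hx hxR => not_lt.mp fun hneg => hx ⟨hxR, hneg⟩

end SignChange

theorem corollary1p5 (n : ℕ) (hn : 1 ≤ n) (α : ℝ)
    (hα₂ : n ≤ 2 → -2 < α) (hα₃ : 3 ≤ n → (n : ℝ) - 4 ≤ α)
    (V : EuclideanSpace ℝ (Fin n) → ℝ)
    (hV : MemLinftyLoc V {0}ᶜ)
    (hVpos : ∀ x : EuclideanSpace ℝ (Fin n), x ≠ 0 → 0 < V x)
    (hVhom : IsHomogeneousOfOrder α V)
    (u : EuclideanSpace ℝ (Fin n) → ℝ)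
    (hu : MemLp u ∞ volume)
    (hsol : IsWeakSolution V u)
    (hu0 : ¬ u =ᵐ[volume] 0) :
    ChangesSignNearInfinity u := by
  have hα (h : 3 ≤ n) : -2 < α := by
    have : (3 : ℝ) ≤ n := mod_cast h
    linarith [hα₃ h]
  exact corollary1p5_general hn ((Nat.lt_or_ge 2 n).elim hα hα₂) hVpos hVhom hu hsol hu0
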